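/- Let $N\ge 1$. A vector $\boldsymbol\alpha=(\alpha_1,\dots,\alpha_m)$ with all $\alpha_i\in(0,1)$ and $\sum_{i=1}^m\alpha_i^N<1$ is called a contraction vector (for $\mathbb R^N$). Let $\mathcal D(\boldsymbol\alpha)$ be the collection of all dust-like self-similar sets in $\mathbb R^N$ with ratios $\boldsymbol\alpha$, i.e. of all nonempty compact $E\subset\mathbb R^N$ for which there are orthogonal matrices $R_i$ and vectors $d_i\in\mathbb R^N$ such that, with $f_i(x)=\alpha_iR_i(x+d_i)$, one has $E=\bigcup_{i=1}^m f_i(E)$ and $f_i(E)\cap f_j(E)=\emptyset$ for $i\ne j$. Two sets $E,F\subset\mathbb R^N$ are Lipschitz equivalent, $E\sim F$, if there are a bijection $\phi:E\to F$ and a constant $C>0$ with $C^{-1}|x-y|\le|\phi(x)-\phi(y)|\le C|x-y|$ for all $x,y\in E$. Write $\mathcal D(\boldsymbol\alpha)\sim\mathcal D(\boldsymbol\beta)$ if $E\sim F$ for some $E\in\mathcal D(\boldsymbol\alpha)$ and $F\in\mathcal D(\boldsymbol\beta)$. Theorem. Let $0<\lambda<1$ and let $a,b,c,d,e$ be positive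 integers such that $\boldsymbol\alpha=(\lambda^a,\lambda^b,\lambda^c)$ and $\boldsymbol\beta=(\lambda^d,\lambda^e)$ are contraction vectors for $\mathbb R^N$, with $\mathcal D(\boldsymbol\alpha)$ and $\mathcal D(\boldsymbol\beta)$ nonempty. Assume that $a=b+c$ and $\gcd(a,b,c)=1$. Then $\mathcal D(\boldsymbol\alpha)\sim\mathcal D(\boldsymbol\beta)$ if and only if one of the following holds: (i) $a=4$, $\{b,c\}=\{1,3\}$ and $\{d,e\}=\{1,2\}$; (ii) $a=8$, $\{b,c\}=\{1,7\}$, and $\{d,e\}=\{1,5\}$ or $\{d,e\}=\{2,3\}$. -/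

import Mathlib

/-- A vector `(α₁, …, α_m)` of contraction ratios in `(0, 1)` is a contraction vector for `ℝᴺ`
if `∑ αᵢᴺ < 1`. -/
def IsContractionVector (N : ℕ) {m : ℕ} (α : Fin m → ℝ) : Prop :=
  (∀ i, 0 < α i ∧ α i < 1) ∧ ∑ i, α i ^ N < 1

/-- `𝒟(α)` in `ℝᴺ`: the collection of all dust-like self-similar sets with ratios `α`, i.e. all
nonempty compact `E` that are the disjoint union of the pieces `fᵢ(E)`, where
`fᵢ(x) = αᵢ Rᵢ (x + dᵢ)` with `Rᵢ` orthogonal and `dᵢ ∈ ℝᴺ`. -/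
def DustLike (N : ℕ) {m : ℕ} (α : Fin m → ℝ) : Set (Set (EuclideanSpace ℝ (Fin N))) :=
  {E | E.Nonempty ∧ IsCompact E ∧
    ∃ (R : Fin m → (EuclideanSpace ℝ (Fin N) ≃ₗᵢ[ℝ] EuclideanSpace ℝ (Fin N)))
      (d : Fin m → EuclideanSpace ℝ (Fin N)),
      E = ⋃ i, (fun x => α i • R i (x + d i)) '' E ∧
      ∀ i j, i ≠ j →
        Disjoint ((fun x => α i • R i (x + d i)) '' E) ((fun x => α j • R j (x + d j)) '' E)}

/-- `E ∼ F`: there is a bi-Lipschitz bijection from `E` onto `F`. -/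
def LipschitzEquivalent {X Y : Type*} [MetricSpace X] [MetricSpace Y]
    (E : Set X) (F : Set Y) : Prop :=
  ∃ (φ : E ≃ F) (C : ℝ), 0 < C ∧
    ∀ x y : E, C⁻¹ * dist x y ≤ dist (φ x) (φ y) ∧ dist (φ x) (φ y) ≤ C * dist x y

/-- `𝒟(α) ∼ 𝒟(β)` in `ℝᴺ`: some member of `𝒟(α)` is Lipschitz equivalent to some member of
`𝒟(β)`. -/
def DustLikeEquivalent (N : ℕ) {m n : ℕ} (α : Fin m → ℝ) (β : Fin n → ℝ) : Prop :=
  ∃ E ∈ DustLike N α, ∃ F ∈ DustLike N β, LipschitzEquivalent E F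

/-! ### Arithmetic of the exponents: polynomials determined by their product with their mirror. -/

section ExponentEquations

open Polynomial

/-! A bi-Lipschitz map preserves the growth rate `p⁻ᵏ` of the number of `lᵏ`-separated points, where
`p ∈ (0, 1)` solves `∑ p ^ w i = 1`. So equivalence gives a common root `p` of `A = X^(b+c) + X^b +
X^c - 1` and `B = X^d + X^e - 1` (`exists_common_root_of_dustLikeEquivalent`), and equality of
dimension alone turns out to decide the exponents.

Let `M` be the minimal polynomial of `p` over `ℤ`, with `A = M * U` and `B = M * V`. By Ljunggren's
method `U` and `V` are self-reciprocal, unless `c = 7 * b` (`mirror_eq_of_mul_mirror_determines`). A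
self-reciprocal `W` satisfies `W'(1) / W(1) = deg W / 2`, so the logarithmic derivatives of `A` and
`B` at `1` give `deg U = deg V + 2e`. But `U` divides both `A` and its mirror, hence `X² + 1`
(`dvd_X_sq_add_one`). Thus `U = X² + 1`, `V = 1`, `e = 1`, which is case (i). In the exceptional
case `b = 1`, `c = 7`, the polynomial `A` factors explicitly, and comparing `B` with `X³ + X² - 1`
in the same way gives `d + 2e = 7`, which is case (ii).

Conversely, compact sets partitioned with the same ratios are bi-Lipschitz equivalent through their
addresses, and in each listed case finitely many subdivisions lead to the same multiset of ratios.
-/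

/-- A self-reciprocal polynomial `W` with nonzero constant term has `2 W'(1) = deg W * W(1)`. -/
theorem two_mul_eval_one_derivative_of_mirror_eq {W : ℤ[X]} (h0 : W.coeff 0 ≠ 0)
    (hW : W.mirror = W) : 2 * W.derivative.eval 1 = W.natDegree * W.eval 1 := by
  have ht : W.natTrailingDegree = 0 := by
    rw [natTrailingDegree_eq_zero]; exact Or.inr h0
  have hc : ∀ k ≤ W.natDegree, W.coeff (W.natDegree - k) = W.coeff k := by
    intro k hk
    conv_rhs => rw [← hW, coeff_mirror, ht, add_zero, revAt_le hk]
  have h1 : W.derivative.eval 1 = ∑ i ∈ Finset.range (W.natDegree + 1), W.coeff i * i := by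
    rw [derivative_eval, sum_over_range]
    · simp
    · simp
  -- The coefficients are palindromic, so `i` may be replaced by `deg W - i`; adding the two forms
  -- of the sum gives the claim.
  have h2 : W.derivative.eval 1 =
      ∑ i ∈ Finset.range (W.natDegree + 1), W.coeff i * ((W.natDegree : ℤ) - i) := by
    rw [h1, ← Finset.sum_range_reflect]
    refine Finset.sum_congr rfl fun i hi => ?_
    have hi' : i ≤ W.natDegree := by simpa [Nat.lt_succ_iff] using hi
    rw [show W.natDegree + 1 - 1 - i = W.natDegree - i by omega, hc i hi', Nat.cast_sub hi']
  have h3 : W.eval 1 = ∑ i ∈ Finset.range (W.natDegree + 1), W.coeff i := by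
    rw [eval_eq_sum_range]; simp
  rw [two_mul]
  nth_rewrite 1 [h1]
  rw [h2, h3, ← Finset.sum_add_distrib, Finset.mul_sum]
  refine Finset.sum_congr rfl fun i _ => ?_
  ring

/-- The product fixes the lowest and highest exponents, so `irreducible_aux3` applies once the
middle coefficients agree; if they are opposite, it is applied to `-p`. -/
theorem Polynomial.IsUnitTrinomial.eq_or_of_mul_mirror_eq {p q : ℤ[X]} (hp : p.IsUnitTrinomial)
    (hpq : p * p.mirror = q * q.mirror) :
    q = p ∨ q = -p ∨ q = p.mirror ∨ q = -p.mirror := by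
  have hq : IsUnitTrinomial q := (isUnitTrinomial_iff'' hpq).mp hp
  obtain ⟨k, m, n, hkm, hmn, u, v, w, hp⟩ := hp
  obtain ⟨k', m', n', hkm', hmn', x, y, z, hq⟩ := hq
  have hk : k = k' := by
    rw [← mul_right_inj' (show 2 ≠ 0 from two_ne_zero), ←
      trinomial_natTrailingDegree hkm hmn u.ne_zero, ← hp, ← natTrailingDegree_mul_mirror, hpq,
      natTrailingDegree_mul_mirror, hq, trinomial_natTrailingDegree hkm' hmn' x.ne_zero]
  have hn : n = n' := by
    rw [← mul_right_inj' (show 2 ≠ 0 from two_ne_zero), ← trinomial_natDegree hkm hmn w.ne_zero, ←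
      hp, ← natDegree_mul_mirror, hpq, natDegree_mul_mirror, hq,
      trinomial_natDegree hkm' hmn' z.ne_zero]
  subst hk
  subst hn
  rcases eq_or_eq_neg_of_sq_eq_sq (y : ℤ) (v : ℤ)
      ((Int.isUnit_sq y.isUnit).trans (Int.isUnit_sq v.isUnit).symm) with
    (h1 | h1)
  · rw [h1] at hq
    rcases irreducible_aux3 hkm hmn hkm' hmn' u v w x z hp hq hpq with (h2 | h2)
    · exact Or.inl h2
    · exact Or.inr (Or.inr (Or.inl h2))
  · rw [h1] at hq
    rw [trinomial_def] at hp
    rw [← neg_inj, neg_add, neg_add, ← neg_mul, ← neg_mul, ← neg_mul, ← C_neg, ← C_neg, ← C_neg]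
      at hp
    rw [← neg_mul_neg, ← mirror_neg] at hpq
    rcases irreducible_aux3 hkm hmn hkm' hmn' (-u) (-v) (-w) x z hp hq hpq with (rfl | rfl)
    · exact Or.inr (Or.inl rfl)
    · exact Or.inr (Or.inr (Or.inr p.mirror_neg))

/-- If `P * P.mirror` determines `P` up to sign and mirroring, then a cofactor of a factor of `P`
having a root that is not a root of `P.mirror` is self-reciprocal. -/
theorem mirror_eq_of_mul_mirror_determines {P M U : ℤ[X]} {x : ℝ} (hP : P = M * U)
    (h1 : P.eval 1 ≠ 0) (hM : aeval x M = 0) (hx : aeval x P.mirror ≠ 0)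
    (hdet : ∀ q : ℤ[X], P * P.mirror = q * q.mirror →
      q = P ∨ q = -P ∨ q = P.mirror ∨ q = -P.mirror) : U.mirror = U := by
  have hP0 : P ≠ 0 := by rintro rfl; simp at h1
  have hM0 : M ≠ 0 := by rintro rfl; simp [hP] at hP0
  have hU0 : U ≠ 0 := by rintro rfl; simp [hP] at hP0
  have hU1 : U.eval 1 ≠ 0 := by
    intro h; apply h1; rw [hP, eval_mul, h, mul_zero]
  have hM1 : M.eval 1 ≠ 0 := by
    intro h; apply h1; rw [hP, eval_mul, h, zero_mul]
  have hU' : U.mirror ≠ 0 := by rwa [Ne, mirror_eq_zero]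
  -- Mirroring only the factor `U` does not change the product with the mirror.
  have key := hdet (M * U.mirror) (by
    rw [hP, mirror_mul_of_domain, mirror_mul_of_domain, mirror_mirror]; ring)
  rcases key with h | h | h | h
  · rw [hP] at h; exact mul_left_cancel₀ hM0 h
  · rw [hP, ← mul_neg] at h
    have h' := congrArg (eval 1) (mul_left_cancel₀ hM0 h)
    rw [mirror_eval_one, eval_neg] at h'
    exact absurd (by linarith) hU1
  -- Here `M` itself would be self-reciprocal, making `x` a root of `P.mirror`.
  · rw [hP, mirror_mul_of_domain] at h
    have h' := mul_right_cancel₀ hU' h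
    exact absurd (by rw [hP, mirror_mul_of_domain, ← h', map_mul, hM, zero_mul]) hx
  · rw [hP, mirror_mul_of_domain, ← neg_mul] at h
    have h' := congrArg (eval 1) (mul_right_cancel₀ hU' h)
    rw [eval_neg, mirror_eval_one] at h'
    exact absurd (by linarith) hM1

theorem mirror_X_pow_add_X_pow_sub_one {d e : ℕ} (he : 0 < e) (hed : e < d) :
    (X ^ d + X ^ e - 1 : ℤ[X]).IsUnitTrinomial ∧
    (X ^ d + X ^ e - 1 : ℤ[X]).natDegree = d ∧
    (X ^ d + X ^ e - 1 : ℤ[X]).mirror = 1 + X ^ (d - e) - X ^ d := by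
  have h : (X ^ d + X ^ e - 1 : ℤ[X]) = trinomial 0 e d (-1) 1 1 := by
    rw [trinomial_def]; simp; ring
  refine ⟨⟨0, e, d, he, hed, -1, 1, 1, by rw [h]; rfl⟩, ?_, ?_⟩
  · rw [h, trinomial_natDegree he hed one_ne_zero]
  · rw [h, trinomial_mirror he hed (by norm_num) one_ne_zero, trinomial_def]; simp; ring

/-- A four-term polynomial with constant term `-1` and leading coefficient `1`. -/
theorem mirror_quadrinomial {n k l : ℕ} (ε : ℤ) (hl : 0 < l) (hlk : l < k) (hkn : k < n) :
    (X ^ n - 1 + C ε * (X ^ k + X ^ l) : ℤ[X]).natDegree = n ∧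
    (X ^ n - 1 + C ε * (X ^ k + X ^ l) : ℤ[X]).mirror =
      1 - X ^ n + C ε * (X ^ (n - k) + X ^ (n - l)) := by
  have hdeg : (X ^ n - 1 + C ε * (X ^ k + X ^ l) : ℤ[X]).natDegree = n := by
    compute_degree
    · simp [show n ≠ 0 by omega, show n ≠ max k l by omega]
    all_goals omega
  have ht : (X ^ n - 1 + C ε * (X ^ k + X ^ l) : ℤ[X]).natTrailingDegree = 0 := by
    rw [natTrailingDegree_eq_zero]; right
    simp [coeff_X_pow, show 0 ≠ k by omega, show 0 ≠ l by omega,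
      show 0 ≠ n by omega]
  refine ⟨hdeg, ?_⟩
  have hone : reflect n (1 : ℤ[X]) = X ^ n := by
    simp
  have hmon : ∀ j ≤ n, reflect n (X ^ j : ℤ[X]) = X ^ (n - j) := by
    intro j hj
    have := reflect_C_mul_X_pow n j (c := (1 : ℤ))
    rw [revAt_le hj] at this; simpa using this
  rw [mirror, ht, pow_zero, mul_one, reverse, hdeg, reflect_add, reflect_sub, reflect_C_mul,
    reflect_add, hone, hmon n le_rfl, hmon k hkn.le, hmon l (hlk.trans hkn).le]
  simp

theorem eq_quadrinomial_of_sum_sq {h : ℤ[X]} {n : ℕ} (hn : 0 < n) (hdeg : h.natDegree = n)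
    (hlead : h.coeff n = 1) (h0 : h.coeff 0 = -1) (hsq : ∑ i ∈ h.support, h.coeff i ^ 2 = 4)
    (h1 : h.eval 1 ^ 2 = 4) :
    ∃ (ε : ℤ) (k l : ℕ), (ε = 1 ∨ ε = -1) ∧ 0 < l ∧ l < k ∧ k < n ∧
      h = X ^ n - 1 + C ε * (X ^ k + X ^ l) := by
  have hns : n ∈ h.support := by rw [mem_support_iff, hlead]; norm_num
  have h0s : 0 ∈ h.support.erase n := by
    rw [Finset.mem_erase, mem_support_iff, h0]; exact ⟨hn.ne, by norm_num⟩
  have hsplit : ∀ {R : Type} [AddCommMonoid R] (g : ℕ → R), ∑ i ∈ h.support, g i =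
      g n + (g 0 + ∑ i ∈ (h.support.erase n).erase 0, g i) := by
    intro R _ g
    rw [← Finset.add_sum_erase _ g hns, ← Finset.add_sum_erase _ g h0s]
  set s := (h.support.erase n).erase 0 with hs
  have hsum : ∑ i ∈ s, h.coeff i ^ 2 = 2 := by
    have := hsplit fun i => h.coeff i ^ 2
    rw [hsq, hlead, h0] at this; linarith
  have hunit : ∀ i ∈ s, h.coeff i ^ 2 = 1 := by
    intro i hi
    have hle := Finset.single_le_sum (fun k _ => sq_nonneg (h.coeff k)) hi
    refine Int.sq_eq_one_of_sq_le_three (by linarith) ?_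
    have : i ∈ h.support := Finset.mem_of_mem_erase (Finset.mem_of_mem_erase hi)
    exact mem_support_iff.mp this
  have hcard : s.card = 2 := by
    have := Finset.sum_congr rfl hunit
    rw [hsum, Finset.sum_const, nsmul_one] at this
    exact_mod_cast this.symm
  obtain ⟨k, l, hkl, hlk⟩ : ∃ k l, l < k ∧ s = {k, l} := by
    obtain ⟨x, y, hxy, hs2⟩ := Finset.card_eq_two.mp hcard
    rcases hxy.lt_or_gt with h | h
    · exact ⟨y, x, h, by rw [hs2, Finset.pair_comm]⟩
    · exact ⟨x, y, h, hs2⟩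
  have hmem : ∀ i ∈ s, 0 < i ∧ i < n := by
    intro i hi
    rw [hs, Finset.mem_erase, Finset.mem_erase] at hi
    refine ⟨Nat.pos_of_ne_zero hi.1, lt_of_le_of_ne ?_ hi.2.1⟩
    rw [← hdeg]; exact le_natDegree_of_mem_supp i hi.2.2
  have hk := hmem k (by rw [hlk]; simp)
  have hl := hmem l (by rw [hlk]; simp)
  have hexp : h = X ^ n - 1 + (C (h.coeff k) * X ^ k + C (h.coeff l) * X ^ l) := by
    conv_lhs => rw [h.as_sum_support_C_mul_X_pow]
    rw [hsplit fun i => C (h.coeff i) * X ^ i, hlk, Finset.sum_pair hkl.ne', hlead, h0]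
    simp; ring
  have hk1 := hunit k (by rw [hlk]; simp)
  have hl1 := hunit l (by rw [hlk]; simp)
  -- Two units whose sum has square `4` have the same sign.
  have he : h.coeff k = h.coeff l := by
    have h2 : h.eval 1 = h.coeff k + h.coeff l := by
      conv_lhs => rw [hexp]
      simp
    rw [h2] at h1
    have h3 : (h.coeff k - h.coeff l) ^ 2 = 0 := by linarith [h1, hk1, hl1]
    exact sub_eq_zero.mp (pow_eq_zero_iff (two_ne_zero) |>.mp h3)
  refine ⟨h.coeff l, k, l, Int.isUnit_iff.mp (.of_pow_eq_one hl1 two_ne_zero), hl.1, hkl, hk.2, ?_⟩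
  conv_lhs => rw [hexp, he]
  ring

/-- The exponents of two quadrinomials with the same product with their mirrors. -/
theorem quadrinomial_exponents {n b c k l : ℕ} {ε : ℤ} (hn : n = b + c) (hb : 0 < b) (hbc : b < c)
    (hε : ε = 1 ∨ ε = -1) (hl : 0 < l) (hlk : l < k) (hkn : k < n)
    (h : (X ^ n - 1 + C ε * (X ^ k + X ^ l) : ℤ[X]) *
        (1 - X ^ n + C ε * (X ^ (n - k) + X ^ (n - l))) =
      (X ^ n - 1 + (X ^ c + X ^ b)) * (1 - X ^ n + (X ^ b + X ^ c))) :
    (k = c ∧ l = b) ∨ c = 7 * b := by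
  have hε2 : (C ε * C ε : ℤ[X]) = 1 := by
    rcases hε with rfl | rfl <;> simp
  -- The expanded hypothesis after cancelling `X ^ (2 * n)`, the constants and all multiples of `X ^
  -- n`.
  have key : (X ^ (n - k + l) + X ^ (n + k - l) : ℤ[X]) +
      C ε * (X ^ k + X ^ l + X ^ (n + (n - k)) + X ^ (n + (n - l))) =
      X ^ (2 * b) + X ^ (2 * c) +
      C ε * (X ^ (n - k) + X ^ (n - l) + X ^ (n + k) + X ^ (n + l)) := by
    have e1 : (X ^ (n - k + l) : ℤ[X]) = X ^ (n - k) * X ^ l := pow_add _ _ _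
    have e2 : (X ^ (n + k - l) : ℤ[X]) = X ^ (n - l) * X ^ k := by
      rw [← pow_add]; congr 1; omega
    have e3 : (X ^ (n - k) * X ^ k : ℤ[X]) = X ^ n := by
      rw [← pow_add]; congr 1; omega
    have e4 : (X ^ (n - l) * X ^ l : ℤ[X]) = X ^ n := by
      rw [← pow_add]; congr 1; omega
    have e5 : (X ^ b * X ^ c : ℤ[X]) = X ^ n := by
      rw [← pow_add, hn]
    rw [e1, e2, pow_add X n (n - k), pow_add X n (n - l), pow_add X n k, pow_add X n l, two_mul,
      two_mul, pow_add, pow_add]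
    linear_combination h + (-(X ^ k + X ^ l) * (X ^ (n - k) + X ^ (n - l))) * hε2
      - e3 - e4 + 2 * e5
  have hco : ∀ j : ℕ, ((if j = n - k + l then 1 else 0) + (if j = n + k - l then 1 else 0) : ℤ) +
      ε * ((if j = k then 1 else 0) + (if j = l then 1 else 0) + (if j = n + (n - k) then 1 else 0)
        + (if j = n + (n - l) then 1 else 0)) =
      (if j = 2 * b then 1 else 0) + (if j = 2 * c then 1 else 0) +
      ε * ((if j = n - k then 1 else 0) + (if j = n - l then 1 else 0) +
        (if j = n + k then 1 else 0) + (if j = n + l then 1 else 0)) := by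
    intro j
    have := congrArg (fun p => coeff p j) key
    simpa only [coeff_add, coeff_C_mul, coeff_X_pow] using this
  obtain ⟨r, rfl⟩ := Nat.exists_eq_add_of_lt hlk
  obtain ⟨s, hs⟩ := Nat.exists_eq_add_of_lt hkn
  -- Below degree `n` only six monomials remain; with `r + 1 = k - l` and `s + 1 = n - k`, their
  -- exponents are the only places to compare coefficients.
  have hco' : ∀ j < n, ((if j = s + 1 + l then 1 else 0 : ℤ)) +
      ε * ((if j = l + r + 1 then 1 else 0) + (if j = l then 1 else 0)) =
      (if j = 2 * b then 1 else 0) +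
      ε * ((if j = s + 1 then 1 else 0) + (if j = r + 1 + s + 1 then 1 else 0)) := by
    intro j hj
    have := hco j
    rw [if_neg (show ¬ j = n + (l + r + 1) - l by omega),
      if_neg (show ¬ j = n + (n - (l + r + 1)) by omega), if_neg (show ¬ j = n + (n - l) by omega),
      if_neg (show ¬ j = 2 * c by omega), if_neg (show ¬ j = n + (l + r + 1) by omega),
      if_neg (show ¬ j = n + l by omega), show n - (l + r + 1) = s + 1 by omega,
      show n - l = r + 1 + s + 1 by omega] at this
    linarith
  have a1 := hco' (2 * b) (by omega)
  have a2 := hco' l (by omega)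
  have a3 := hco' (l + r + 1) (by omega)
  have a4 := hco' (r + 1 + s + 1) (by omega)
  have a5 := hco' (s + 1) (by omega)
  have a6 := hco' (s + 1 + l) (by omega)
  clear hco hco' key h hε2
  rcases hε with rfl | rfl
  · grind (splits := 40)
  · grind (splits := 40)
-- The central coefficient of `q * q.mirror` is the sum of the squared coefficients of `q`, which
-- forces `q` to have four unit coefficients as well. The case `c = 7 * b` is a true exception: `X^8
-- + X^7 + X - 1` and `X^8 + X^4 + X^2 - 1` have the same product with their mirrors.
theorem quadrinomial_eq_or_of_mul_mirror_eq {b c : ℕ} (hb : 0 < b) (hbc : b < c) (h7 : c ≠ 7 * b)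
    {A q : ℤ[X]} (hA : A = X ^ (b + c) - 1 + C 1 * (X ^ c + X ^ b))
    (h : A * A.mirror = q * q.mirror) : q = A ∨ q = -A ∨ q = A.mirror ∨ q = -A.mirror := by
  obtain ⟨hdeg, hmir⟩ := mirror_quadrinomial 1 hb hbc (show c < b + c by omega)
  rw [← hA] at hdeg hmir
  rw [show b + c - c = b by omega, show b + c - b = c by omega] at hmir
  have hprod : A * A.mirror = -X ^ (2 * (b + c)) + X ^ (2 * b) + X ^ (2 * c) +
      C 4 * X ^ (b + c) - C 1 := by
    rw [hmir, hA]; simp only [map_one, map_ofNat, pow_mul', pow_add]; ring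
  have hA0 : A ≠ 0 := by
    rintro rfl; simp at hdeg; omega
  have hA1 : A.eval 1 = 2 := by rw [hA]; simp
  have htA : A.natTrailingDegree = 0 := by
    rw [natTrailingDegree_eq_zero]; right
    rw [hA]
    simp [coeff_X_pow, show 0 ≠ b by omega, show 0 ≠ c by omega,
      show ¬ 0 = b + c by omega]
  have hqdeg : q.natDegree = b + c := by
    have := natDegree_mul_mirror q
    rw [← h, natDegree_mul_mirror, hdeg] at this
    omega
  have hqt : q.natTrailingDegree = 0 := by
    have := natTrailingDegree_mul_mirror q
    rw [← h, natTrailingDegree_mul_mirror, htA] at this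
    omega
  have hsq : ∑ i ∈ q.support, q.coeff i ^ 2 = 4 := by
    have h1 := coeff_mul_mirror q
    rw [hqdeg, hqt, ← h, add_zero, hprod] at h1
    rw [sum_def] at h1
    rw [← h1]
    simp [coeff_X_pow, show ¬ (b + c = 2 * b) by omega, show ¬ (b + c = 2 * c) by omega,
      show ¬ (b = 0) by omega, coeff_one, show ¬ (c = 0) by omega]
  have hlead : q.coeff (b + c) * q.coeff 0 = -1 := by
    have h1 : (A * A.mirror).coeff 0 = -1 := by
      rw [hprod]
      simp [show b ≠ 0 by omega, show c ≠ 0 by omega, show ¬ 0 = b + c by omega]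
    rw [h, mul_coeff_zero, coeff_mirror, hqt, hqdeg, revAt_le (by omega)] at h1
    simpa [mul_comm] using h1
  have heval : q.eval 1 ^ 2 = 4 := by
    have := congrArg (eval 1) h
    rw [eval_mul, eval_mul, mirror_eval_one, mirror_eval_one, hA1] at this
    rw [sq, ← this]; norm_num
  have main : ∀ r : ℤ[X], A * A.mirror = r * r.mirror → r.natDegree = b + c →
      r.coeff (b + c) = 1 → r.coeff 0 = -1 → ∑ i ∈ r.support, r.coeff i ^ 2 = 4 →
      r.eval 1 ^ 2 = 4 → r = A ∨ r = -A.mirror := by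
    intro r hr h1 h2 h3 h4 h5
    obtain ⟨ε, k, l, hε, hl, hlk, hkn, hrr⟩ :=
      eq_quadrinomial_of_sum_sq (show 0 < b + c by omega) h1 h2 h3 h4 h5
    have hrm := (mirror_quadrinomial ε hl hlk hkn).2
    rw [← hrr] at hrm
    rw [hrm, hrr, hmir, hA] at hr
    rcases quadrinomial_exponents rfl hb hbc hε hl hlk hkn (by
      rw [← hr]; simp) with ⟨rfl, rfl⟩ | h
    · rcases hε with rfl | rfl
      · left; rw [hrr, hA]
      · right; rw [hrr, hmir]; simp; ring
    · exact absurd h h7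
  -- Up to replacing `q` by `-q`, the leading coefficient is `1` and the constant term `-1`.
  rcases Int.mul_eq_neg_one_iff_eq_one_or_neg_one.mp hlead with ⟨h1, h2⟩ | ⟨h1, h2⟩
  · rcases main q h hqdeg h1 h2 hsq heval with h | h
    · exact Or.inl h
    · exact Or.inr (Or.inr (Or.inr h))
  · have := main (-q) (by rw [h, mirror_neg, neg_mul_neg]) (by rw [natDegree_neg, hqdeg])
      (by rw [coeff_neg, h1, neg_neg]) (by rw [coeff_neg, h2])
      (by simpa using hsq) (by simpa using heval)
    rcases this with h | h
    · exact Or.inr (Or.inl (by rw [← h, neg_neg]))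
    · exact Or.inr (Or.inr (Or.inl (neg_injective h)))

/-- Comparing the two values of `y ^ (b * c)` shows that `b` and `c` have equal parity, so both are
odd. A Bézout relation `b * s = c * t + 1` then has `s`, `t` of opposite parity and isolates `y`. -/
theorem eq_neg_one_of_pow_eq_neg_one {R : Type*} [CommRing R] (htwo : (1 : R) ≠ -1) {b c : ℕ}
    (hc : 1 < c) (hcop : b.Coprime c) {y : R} (y3 : y ^ b = -1) (y4 : y ^ c = -1) : y = -1 := by
  have hbc1 : y ^ (b * c) = (-1) ^ c := by rw [pow_mul, y3]
  have hbc2 : y ^ (b * c) = (-1) ^ b := by rw [mul_comm, pow_mul, y4]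
  have hodd : Odd b ∧ Odd c := by
    rcases Nat.even_or_odd b with hb | hb <;> rcases Nat.even_or_odd c with hc | hc
    · have := Nat.dvd_gcd hb.two_dvd hc.two_dvd
      rw [hcop] at this; omega
    · have h := hbc2.symm.trans hbc1
      rw [hb.neg_one_pow, hc.neg_one_pow] at h
      exact absurd h htwo
    · have h := hbc1.symm.trans hbc2
      rw [hb.neg_one_pow, hc.neg_one_pow] at h
      exact absurd h htwo
    · exact ⟨hb, hc⟩
  obtain ⟨s, hs⟩ := Nat.exists_mul_mod_eq_one_of_coprime hcop hc
  have hst : b * s = c * (b * s / c) + 1 := by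
    have := Nat.div_add_mod (b * s) c
    omega
  set t := b * s / c
  have hys : (-1) ^ s = (-1) ^ t * y := by
    rw [← y3, ← pow_mul, hst, pow_add, pow_mul, y4, pow_one, y3]
  have hpar := congrArg (Even ·) hst
  simp only [Nat.even_add_one, Nat.even_mul, Nat.not_even_iff_odd.mpr hodd.1,
    Nat.not_even_iff_odd.mpr hodd.2, false_or, eq_iff_iff] at hpar
  rcases Nat.even_or_odd t with ht | ht
  · have hs' : Odd s := by rw [← Nat.not_even_iff_odd, hpar]; exact not_not.mpr ht
    rw [hs'.neg_one_pow, ht.neg_one_pow, one_mul] at hys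
    exact hys.symm
  · have hs' : Even s := by rw [hpar]; exact Nat.not_even_iff_odd.mpr ht
    rw [hs'.neg_one_pow, ht.neg_one_pow] at hys
    rw [hys]; ring

/-- A self-reciprocal divisor of `X ^ (b + c) + X ^ b + X ^ c - 1` divides `X ^ 2 + 1`. -/
theorem dvd_X_sq_add_one {b c : ℕ} (hbc : b < c) (hcop : b.Coprime c) {U : ℤ[X]}
    (hU : U.Monic) (hU0 : 0 < U.natDegree)
    (h1 : U ∣ X ^ (b + c) - 1 + (X ^ c + X ^ b)) (h2 : U ∣ 1 - X ^ (b + c) + (X ^ b + X ^ c)) :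
    U ∣ X ^ 2 + 1 := by
  -- `U` is monic, so the prime constant `2` cannot divide it and can be cancelled.
  have cancel : ∀ f : ℤ[X], U ∣ C 2 * f → U ∣ f := by
    rintro f ⟨W, hW⟩
    have hp : Prime (C 2 : ℤ[X]) := prime_C_iff.mpr Int.prime_two
    have hd : (C 2 : ℤ[X]) ∣ U * W := ⟨f, hW.symm⟩
    rcases hp.dvd_or_dvd hd with h | ⟨g, rfl⟩
    · rw [C_dvd_iff_dvd_coeff] at h
      have := h U.natDegree
      rw [hU.coeff_natDegree] at this
      norm_num at this
    · refine ⟨g, mul_left_cancel₀ hp.ne_zero ?_⟩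
      rw [hW]; ring
  have e1 : U ∣ X ^ (b + c) - 1 := by
    refine cancel _ ?_
    have := dvd_sub h1 h2
    convert this using 1
    rw [show (C 2 : ℤ[X]) = 2 by simp]; ring
  have e2 : U ∣ X ^ b + X ^ c := by
    refine cancel _ ?_
    have := dvd_add h1 h2
    convert this using 1
    rw [show (C 2 : ℤ[X]) = 2 by simp]; ring
  have e3 : U ∣ (X ^ 2) ^ b + 1 := by
    have := dvd_sub (e2.mul_left (X ^ b)) e1
    convert this using 1
    rw [pow_add]; ring
  have e4 : U ∣ (X ^ 2) ^ c + 1 := by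
    have := dvd_sub (e2.mul_left (X ^ c)) e1
    convert this using 1
    rw [pow_add]; ring
  have hq : ∀ f : ℤ[X], U ∣ f ↔ Ideal.Quotient.mk (Ideal.span {U}) f = 0 := by
    intro f; rw [Ideal.Quotient.eq_zero_iff_mem, Ideal.mem_span_singleton]
  rw [hq] at e3 e4 ⊢
  simp only [map_add, map_pow, map_one] at e3 e4 ⊢
  set y := (Ideal.Quotient.mk (Ideal.span {U}) X) ^ 2 with hy
  have y3 : y ^ b = -1 := eq_neg_of_add_eq_zero_left e3
  have y4 : y ^ c = -1 := eq_neg_of_add_eq_zero_left e4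
  have htwo : ¬ ((1 : ℤ[X] ⧸ Ideal.span {U}) = -1) := by
    intro h
    have h2 : U ∣ C 2 := by
      rw [hq, show (C 2 : ℤ[X]) = 1 + 1 by rw [one_add_one_eq_two]; simp, map_add, map_one]
      nth_rewrite 1 [h]; simp
    have := natDegree_le_of_dvd h2 (by simp)
    simp at this; omega
  have hc : 1 < c := by
    rcases Nat.eq_zero_or_pos b with rfl | hb
    · simp at y3; exact absurd y3 htwo
    · omega
  exact eq_neg_iff_add_eq_zero.mp (eq_neg_one_of_pow_eq_neg_one htwo hc hcop y3 y4)

/-! ### Minimal polynomial of the common root and its cofactors. -/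

theorem two_le_natDegree_minpoly_int {p : ℝ} (hp0 : 0 < p) (hp1 : p < 1) (hint : IsIntegral ℤ p) :
    2 ≤ (minpoly ℤ p).natDegree := by
  by_contra! hlt
  have h1 := minpoly.aeval ℤ p
  have hpos := minpoly.natDegree_pos hint
  have hmon := minpoly.monic hint
  have hd : (minpoly ℤ p).natDegree = 1 := by omega
  rw [hmon.eq_X_add_C hd] at h1
  rw [map_add, aeval_X, aeval_C, algebraMap_int_eq, eq_intCast] at h1
  have h2 : ((-(minpoly ℤ p).coeff 0 : ℤ) : ℝ) = p := by push_cast; linarith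
  rw [← h2] at hp0 hp1
  have h3 : 0 < -(minpoly ℤ p).coeff 0 := by exact_mod_cast hp0
  have h4 : -(minpoly ℤ p).coeff 0 < 1 := by exact_mod_cast hp1
  omega

theorem exists_eq_minpoly_int_mul {p : ℝ} (hint : IsIntegral ℤ p) {P : ℤ[X]}
    (hP : P.Monic) (hroot : aeval p P = 0) : ∃ U : ℤ[X], U.Monic ∧ P = minpoly ℤ p * U ∧
      P.natDegree = (minpoly ℤ p).natDegree + U.natDegree := by
  obtain ⟨U, hU⟩ := minpoly.isIntegrallyClosed_dvd hint hroot
  have hm : U.Monic := (minpoly.monic hint).of_mul_monic_left (hU ▸ hP)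
  refine ⟨U, hm, hU, ?_⟩
  rw [hU, (minpoly.monic hint).natDegree_mul hm]

/-- The cofactor of the minimal polynomial of a root in `(0, 1)` in a trinomial is
self-reciprocal. -/
theorem trinomial_cofactor {p : ℝ} (hp0 : 0 < p) (hp1 : p < 1) (hint : IsIntegral ℤ p)
    {d e : ℕ} (he : 0 < e) (hed : e < d) (hroot : p ^ d + p ^ e = 1) :
    ∃ V : ℤ[X], V.Monic ∧ (X ^ d + X ^ e - 1 : ℤ[X]) = minpoly ℤ p * V ∧
      d = (minpoly ℤ p).natDegree + V.natDegree ∧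
      (minpoly ℤ p).eval 1 * V.eval 1 = 1 ∧
      2 * V.derivative.eval 1 = V.natDegree * V.eval 1 ∧
      (d : ℤ) + e = (minpoly ℤ p).derivative.eval 1 * V.eval 1 +
        (minpoly ℤ p).eval 1 * V.derivative.eval 1 := by
  obtain ⟨htri, hdeg, hmir⟩ := mirror_X_pow_add_X_pow_sub_one he hed
  have hmonic : (X ^ d + X ^ e - 1 : ℤ[X]).Monic := by
    rw [Monic, leadingCoeff, hdeg]
    simp [coeff_X_pow, coeff_one, show d ≠ e by omega, show d ≠ 0 by omega]
  obtain ⟨V, hV, hBV, hdV⟩ := exists_eq_minpoly_int_mul hint hmonic (by simp [hroot])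
  have hone : (minpoly ℤ p).eval 1 * V.eval 1 = 1 := by
    have := congrArg (eval 1) hBV
    rw [eval_mul] at this; rw [← this]; simp
  have hV0 : V.coeff 0 ≠ 0 := by
    intro h
    have := congrArg (fun f => coeff f 0) hBV
    simp only [mul_coeff_zero, h] at this
    simp [show ¬ 0 = e by omega, show ¬ 0 = d by omega] at this
  have hVm : V.mirror = V := by
    refine mirror_eq_of_mul_mirror_determines (x := p) hBV (by simp) (minpoly.aeval ℤ p) ?_
      fun q => htri.eq_or_of_mul_mirror_eq
    rw [hmir]
    -- Since `0 < p < 1`, the mirror `1 + X ^ (d - e) - X ^ d` is positive at `p`.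
    have h1 : p ^ d < 1 := pow_lt_one₀ hp0.le hp1 (by omega)
    have h2 : 0 < p ^ (d - e) := pow_pos hp0 _
    simp only [map_sub, map_add, map_one, map_pow, aeval_X]
    exact ne_of_gt (by linarith)
  refine ⟨V, hV, hBV, by rw [← hdV, hdeg], hone,
    two_mul_eval_one_derivative_of_mirror_eq hV0 hVm, ?_⟩
  have := congrArg (fun f => eval 1 (derivative f)) hBV
  simp only [derivative_mul, eval_add, eval_mul] at this
  rw [← this]; simp [derivative_X_pow]

theorem quadrinomial_trinomial_exponents {p : ℝ} (hp0 : 0 < p) (hp1 : p < 1) {b c d e : ℕ}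
    (hb : 0 < b) (hbc : b < c) (hcop : b.Coprime c) (h7 : c ≠ 7 * b) (he : 0 < e) (hed : e < d)
    (hA : p ^ (b + c) + p ^ b + p ^ c = 1) (hB : p ^ d + p ^ e = 1) :
    b = 1 ∧ c = 3 ∧ d = 2 ∧ e = 1 := by
  obtain ⟨hdeg, hmir⟩ := mirror_quadrinomial 1 hb hbc (show c < b + c by omega)
  rw [show b + c - c = b by omega, show b + c - b = c by omega] at hmir
  set A : ℤ[X] := X ^ (b + c) - 1 + C 1 * (X ^ c + X ^ b) with hAdef
  have hA' : A = X ^ (b + c) - 1 + (X ^ c + X ^ b) := by rw [hAdef]; simp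
  have hmonic : A.Monic := by
    rw [Monic, leadingCoeff, hdeg, hA']
    simp [coeff_X_pow, coeff_one, show ¬ b = 0 by omega, show ¬ c = 0 by omega]
  have hroot : aeval p A = 0 := by rw [hA']; simp; linarith
  have hint : IsIntegral ℤ p := ⟨A, hmonic, by simpa [aeval_def] using hroot⟩
  obtain ⟨U, hU, hAU, hdU⟩ := exists_eq_minpoly_int_mul hint hmonic hroot
  obtain ⟨V, hV, hBV, hdV, hV1, hVd, hVB⟩ := trinomial_cofactor hp0 hp1 hint he hed hB
  rw [hdeg] at hdU
  have hA1 : A.eval 1 = 2 := by rw [hA']; simp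
  have hU1 : (minpoly ℤ p).eval 1 * U.eval 1 = 2 := by rw [← eval_mul, ← hAU, hA1]
  have hU0 : U.coeff 0 ≠ 0 := by
    intro h
    have := congrArg (fun f => coeff f 0) hAU
    simp only [mul_coeff_zero, h] at this
    simp [hA', show ¬ 0 = b + c by omega, show ¬ 0 = b by omega, show ¬ 0 = c by omega] at this
  have hUm : U.mirror = U := by
    refine mirror_eq_of_mul_mirror_determines (x := p) hAU (by rw [hA1]; norm_num)
      (minpoly.aeval ℤ p) ?_ fun q =>
        quadrinomial_eq_or_of_mul_mirror_eq hb hbc h7 rfl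
    rw [hmir]
    have h1 : p ^ (b + c) < 1 := pow_lt_one₀ hp0.le hp1 (by omega)
    have h2 : 0 < p ^ b := pow_pos hp0 _
    have h3 : 0 < p ^ c := pow_pos hp0 _
    simp only [map_sub, map_add, map_one, map_pow, aeval_X, one_mul]
    exact ne_of_gt (by linarith)
  have hUd := two_mul_eval_one_derivative_of_mirror_eq hU0 hUm
  have hUA : (2 * (b + c) : ℤ) = (minpoly ℤ p).derivative.eval 1 * U.eval 1 +
      (minpoly ℤ p).eval 1 * U.derivative.eval 1 := by
    have := congrArg (fun f => eval 1 (derivative f)) hAU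
    simp only [derivative_mul, eval_add, eval_mul] at this
    rw [← this, hA']; simp [derivative_X_pow]; ring
  -- With `m = M'(1) / M(1)`, logarithmic derivatives at `1` give `b + c = m + deg U / 2` and `d + e
  -- = m + deg V / 2`; subtract and use `b + c = deg M + deg U`, `d = deg M + deg V`.
  have hUV : U.natDegree = V.natDegree + 2 * e := by
    have hm : (minpoly ℤ p).eval 1 = V.eval 1 := Int.eq_of_mul_eq_one hV1
    have hu : U.eval 1 = 2 * V.eval 1 := by
      have hVsq : V.eval 1 * V.eval 1 = 1 := by rw [← hm]; nth_rewrite 2 [hm]; exact hV1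
      calc U.eval 1 = V.eval 1 * V.eval 1 * U.eval 1 := by rw [hVsq, one_mul]
        _ = 2 * V.eval 1 := by rw [mul_assoc, ← hm, hU1]; ring
    have hVsq : V.eval 1 * V.eval 1 = 1 := by rw [← hm]; nth_rewrite 2 [hm]; exact hV1
    rw [hu] at hUA hUd
    rw [hm] at hUA hVB
    have h1 : 2 * (2 * (b + c) : ℤ) =
        2 * (2 * ((minpoly ℤ p).derivative.eval 1 * V.eval 1)) + 2 * U.natDegree := by
      linear_combination 2 * hUA + V.eval 1 * hUd + 2 * (U.natDegree : ℤ) * hVsq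
    have h2 : 2 * ((d : ℤ) + e) =
        2 * ((minpoly ℤ p).derivative.eval 1 * V.eval 1) + V.natDegree := by
      linear_combination 2 * hVB + V.eval 1 * hVd + (V.natDegree : ℤ) * hVsq
    have h3 : ((b + c : ℕ) : ℤ) = (minpoly ℤ p).natDegree + U.natDegree := by exact_mod_cast hdU
    have h4 : (d : ℤ) = (minpoly ℤ p).natDegree + V.natDegree := by exact_mod_cast hdV
    push_cast at h3
    omega
  have hUdvd : U ∣ X ^ 2 + 1 := by
    refine dvd_X_sq_add_one hbc hcop hU (by omega) (hA' ▸ ⟨_, (hAU.trans (mul_comm _ _))⟩) ?_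
    have h1 : A.mirror = 1 - X ^ (b + c) + (X ^ b + X ^ c) := by rw [hmir]; simp
    rw [← h1, hAU, mirror_mul_of_domain, hUm]
    exact dvd_mul_left _ _
  have hXd : (X ^ 2 + 1 : ℤ[X]).natDegree = 2 := by compute_degree!
  have hU2 : U.natDegree ≤ 2 := by
    rw [← hXd]
    refine natDegree_le_of_dvd hUdvd fun h => ?_
    rw [h] at hXd; simp at hXd
  have he1 : e = 1 := by omega
  have hV0 : V = 1 := hV.natDegree_eq_zero.mp (by omega)
  have hUeq : U = X ^ 2 + 1 := by
    refine (eq_of_monic_of_dvd_of_natDegree_le hU ?_ hUdvd (by omega)).symm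
    rw [Monic, leadingCoeff, hXd]; simp [coeff_one]
  rw [hV0, mul_one] at hBV
  rw [← hBV, hUeq, hA'] at hAU
  -- The left side has nonnegative coefficient at `X ^ 2`; on the right the term `-X ^ 2` must be
  -- compensated, which only `X ^ d` with `d = 2` can do.
  have hc2 := congrArg (fun f => coeff f 2) hAU
  have hexp : ((X ^ d + X ^ e - 1) * (X ^ 2 + 1) : ℤ[X]) =
      X ^ (d + 2) + X ^ d + X ^ 3 - X ^ 2 + X ^ 1 - 1 := by
    rw [he1]; ring
  rw [hexp] at hc2
  simp only [coeff_add, coeff_sub, coeff_X_pow, coeff_one] at hc2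
  have hd2 : d = 2 := by
    by_contra hd2
    rw [if_neg (show ¬ 2 = d + 2 by omega), if_neg (show ¬ 2 = d by omega),
      if_neg (show ¬ 2 = b + c by omega)] at hc2
    split_ifs at hc2 <;> omega
  have : b + c = 4 := by omega
  refine ⟨?_, ?_, hd2, he1⟩
  · rcases (show b = 1 ∨ b = 2 by omega) with h | h
    · exact h
    · omega
  · omega

theorem trinomial_exponents_of_seven {p : ℝ} (hp0 : 0 < p) (hp1 : p < 1) {d e : ℕ}
    (he : 0 < e) (hed : e < d)
    (hA : p ^ 8 + p ^ 1 + p ^ 7 = 1) (hB : p ^ d + p ^ e = 1) :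
    (d = 5 ∧ e = 1) ∨ (d = 3 ∧ e = 2) := by
  have h3 : p ^ 3 + p ^ 2 = 1 := by
    -- The factorization of `X^8 + X^7 + X - 1`; only its last factor can vanish on `(0, 1)`.
    have h1 : (p ^ 2 + 1) * ((p ^ 3 - p + 1) * (p ^ 3 + p ^ 2 - 1)) = 0 := by
      linear_combination hA
    have h2 : p ^ 2 + 1 ≠ 0 := by positivity
    have h4 : p ^ 3 - p + 1 ≠ 0 := by
      have : 0 < p ^ 3 := pow_pos hp0 3
      exact ne_of_gt (by linarith)
    have := (mul_eq_zero.mp ((mul_eq_zero.mp h1).resolve_left h2)).resolve_left h4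
    linarith
  have hint : IsIntegral ℤ p := by
    refine ⟨X ^ 3 + X ^ 2 - 1, ?_, by simp [h3]⟩
    monicity!
  have h2 := two_le_natDegree_minpoly_int hp0 hp1 hint
  obtain ⟨W, hW, -, hdW, hW1, hWd, hWB⟩ := trinomial_cofactor hp0 hp1 hint two_pos
    (by norm_num) h3
  obtain ⟨V, hV, -, hdV, hV1, hVd, hVB⟩ := trinomial_cofactor hp0 hp1 hint he hed hB
  have hm : (minpoly ℤ p).eval 1 = V.eval 1 := Int.eq_of_mul_eq_one hV1
  have hm' : (minpoly ℤ p).eval 1 = W.eval 1 := Int.eq_of_mul_eq_one hW1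
  have hsq : V.eval 1 * V.eval 1 = 1 := by rw [← hm]; nth_rewrite 2 [hm]; exact hV1
  rw [← hm', hm] at hWd hWB
  rw [hm] at hVB
  -- Both trinomials share the minimal polynomial, so the two identities combine to `d + 2 * e = 7`.
  have e1 : 2 * ((d : ℤ) + e) =
      2 * ((minpoly ℤ p).derivative.eval 1 * V.eval 1) + V.natDegree := by
    linear_combination 2 * hVB + V.eval 1 * hVd + (V.natDegree : ℤ) * hsq
  have e2 : 2 * (((3 : ℕ) : ℤ) + (2 : ℕ)) =
      2 * ((minpoly ℤ p).derivative.eval 1 * V.eval 1) + W.natDegree := by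
    linear_combination 2 * hWB + V.eval 1 * hWd + (W.natDegree : ℤ) * hsq
  omega

theorem not_two_mul_pow_eq_one {p : ℝ} (hint : IsIntegral ℤ p) (d : ℕ) : p ^ d + p ^ d ≠ 1 := by
  intro h
  have h1 : IsIntegral ℤ (algebraMap ℚ ℝ (1 / 2)) := by
    have : algebraMap ℚ ℝ (1 / 2) = p ^ d := by simp; linarith
    rw [this]; exact hint.pow d
  rw [isIntegral_algebraMap_iff (algebraMap ℚ ℝ).injective] at h1
  obtain ⟨z, hz⟩ := IsIntegrallyClosed.isIntegral_iff.mp h1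
  simp only [algebraMap_int_eq, eq_intCast] at hz
  have h2 : ((2 * z : ℤ) : ℚ) = (1 : ℤ) := by push_cast; rw [hz]; norm_num
  have h3 : 2 * z = 1 := by exact_mod_cast h2
  omega

/-- The degree bound makes `X^2 + 2X - 1` the minimal polynomial. Its value `2` at `1` would have to
divide the value `1` of the trinomial. -/
theorem not_trinomial_of_sq_add_two_mul {p : ℝ} (hp0 : 0 < p) (hp1 : p < 1) {d e : ℕ}
    (he : 0 < e) (hed : e < d) (hA : p ^ 2 + p + p = 1) : p ^ d + p ^ e ≠ 1 := by
  intro hB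
  have hdeg : (X ^ 2 + X + X - 1 : ℤ[X]).natDegree = 2 := by compute_degree!
  have hmonic : (X ^ 2 + X + X - 1 : ℤ[X]).Monic := by monicity!
  have hroot : aeval p (X ^ 2 + X + X - 1 : ℤ[X]) = 0 := by
    simp; linarith
  have hint : IsIntegral ℤ p := ⟨_, hmonic, by simpa [aeval_def] using hroot⟩
  obtain ⟨U, hU, hAU, hdU⟩ := exists_eq_minpoly_int_mul hint hmonic hroot
  obtain ⟨V, hV, -, -, hV1, -, -⟩ := trinomial_cofactor hp0 hp1 hint he hed hB
  have h2 := two_le_natDegree_minpoly_int hp0 hp1 hint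
  rw [hdeg] at hdU
  have hU1 : U = 1 := hU.natDegree_eq_zero.mp (by omega)
  rw [hU1, mul_one] at hAU
  rw [← hAU] at hV1
  simp at hV1
  omega

/-- The exponents `b + c, b, c` and `d, e` that have a common root in `(0, 1)`. -/
theorem exponents_of_common_root {p : ℝ} (hp0 : 0 < p) (hp1 : p < 1) {b c d e : ℕ}
    (hb : 0 < b) (hbc : b ≤ c) (hcop : b.Coprime c) (he : 0 < e) (hed : e ≤ d)
    (hA : p ^ (b + c) + p ^ b + p ^ c = 1) (hB : p ^ d + p ^ e = 1) :
    (b = 1 ∧ c = 3 ∧ d = 2 ∧ e = 1) ∨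
      (b = 1 ∧ c = 7 ∧ ((d = 5 ∧ e = 1) ∨ (d = 3 ∧ e = 2))) := by
  have hint : IsIntegral ℤ p := by
    refine ⟨X ^ (b + c) + (X ^ b + X ^ c - 1), ?_, by simp [eval₂_add, eval₂_sub]; linarith⟩
    refine monic_X_pow_add ?_
    refine lt_of_le_of_lt (degree_sub_le _ _) (max_lt (lt_of_le_of_lt (degree_add_le _ _) ?_) ?_)
    · simp only [degree_X_pow]
      exact max_lt (by exact_mod_cast (by omega : b < b + c))
        (by exact_mod_cast (by omega : c < b + c))
    · rw [degree_one]; exact_mod_cast (by omega : 0 < b + c)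
  rcases hed.eq_or_lt with rfl | hed
  · exact absurd hB (not_two_mul_pow_eq_one hint _)
  rcases hbc.eq_or_lt with rfl | hbc
  · have hb1 : b = 1 := by simpa using hcop
    subst hb1
    exact absurd hB (not_trinomial_of_sq_add_two_mul hp0 hp1 he hed (by simpa using hA))
  by_cases h7 : c = 7 * b
  · have hb1 : b = 1 := hcop.eq_one_of_dvd ⟨7, by rw [h7, mul_comm]⟩
    subst hb1; subst h7
    exact Or.inr ⟨rfl, rfl, trinomial_exponents_of_seven hp0 hp1 he hed hA hB⟩
  · exact Or.inl (quadrinomial_trinomial_exponents hp0 hp1 hb hbc hcop h7 he hed hA hB)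

end ExponentEquations

/-! ### Counting separated points in a self-similar space. -/

section SimilarityPartitions

open Filter Topology

/-- A partition of the metric space `X` into images of `X` under similarities `map i` of ratios
`l ^ w i`. -/
structure SimilarityPartition (l : ℝ) (X : Type*) [MetricSpace X] {ι : Type*} (w : ι → ℕ) where
  /-- The similarities. -/
  map : ι → X → X
  dist_map : ∀ i x y, dist (map i x) (map i y) = l ^ w i * dist x y
  exists_map_eq : ∀ x, ∃ i y, map i y = x
  eq_of_map_eq : ∀ {i j x y}, map i x = map j y → i = j

namespace SimilarityPartition

variable {l : ℝ} {X Y : Type*} [MetricSpace X] [MetricSpace Y] {ι κ : Type*} {w : ι → ℕ}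
  {v : κ → ℕ}

theorem map_injective (P : SimilarityPartition l X w) (hl : 0 < l) (i : ι) :
    Function.Injective (P.map i) := by
  intro x y h
  have := P.dist_map i x y
  rw [h, dist_self] at this
  have h2 := (mul_eq_zero.mp this.symm).resolve_left (pow_pos hl _).ne'
  exact dist_eq_zero.mp h2

theorem continuous_map (P : SimilarityPartition l X w) (hl : 0 < l) (i : ι) :
    Continuous (P.map i) := by
  refine (LipschitzWith.of_dist_le_mul (K := ⟨l ^ w i, (pow_pos hl _).le⟩) fun x y => ?_).continuous
  exact (P.dist_map i x y).le

theorem exists_gap [CompactSpace X] [Finite ι] (P : SimilarityPartition l X w) (hl : 0 < l) :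
    ∃ γ > 0, ∀ i j, i ≠ j → ∀ x y, γ ≤ dist (P.map i x) (P.map j y) := by
  have key : ∀ i j, ∀ᶠ γ in 𝓝[>] (0 : ℝ), i ≠ j → ∀ x y, γ ≤ dist (P.map i x) (P.map j y) := by
    intro i j
    by_cases hij : i = j
    · simp [hij]
    rcases isEmpty_or_nonempty X with hX | hX
    · exact Eventually.of_forall fun _ _ x => isEmptyElim x
    have hcont : Continuous fun z : X × X => dist (P.map i z.1) (P.map j z.2) :=
      ((P.continuous_map hl i).comp continuous_fst).dist
        ((P.continuous_map hl j).comp continuous_snd)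
    obtain ⟨z, -, hz⟩ := isCompact_univ.exists_isMinOn Set.univ_nonempty hcont.continuousOn
    have hpos : 0 < dist (P.map i z.1) (P.map j z.2) :=
      dist_pos.mpr fun h => hij (P.eq_of_map_eq h)
    filter_upwards [Ioo_mem_nhdsGT hpos] with γ hγ _ x y
    exact hγ.2.le.trans (hz (Set.mem_univ (x, y)))
  have h2 : ∀ᶠ γ in 𝓝[>] (0 : ℝ), ∀ i j, i ≠ j → ∀ x y, γ ≤ dist (P.map i x) (P.map j y) :=
    eventually_all.mpr fun i => eventually_all.mpr fun j => key i j
  obtain ⟨γ, h, hγ⟩ := (h2.and self_mem_nhdsWithin).exists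
  exact ⟨γ, hγ, h⟩

/-- There are at least `c * p⁻ᵏ` points at mutual distance at least `lᵏ`, where `∑ p ^ w i = 1`. -/
theorem exists_separated_finset [CompactSpace X] [Nonempty X] [Fintype ι]
    (P : SimilarityPartition l X w) (hl : 0 < l) (hl1 : l < 1) (hw : ∀ i, 0 < w i) {p : ℝ}
    (hp : 0 < p) (hp1 : p < 1) (hsum : ∑ i, p ^ w i = 1) :
    ∃ c > 0, ∀ k : ℕ, ∃ S : Finset X, (∀ x ∈ S, ∀ y ∈ S, x ≠ y → l ^ k ≤ dist x y) ∧
      c ≤ S.card * p ^ k := by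
  classical
  obtain ⟨γ, hγ, hgap⟩ := P.exists_gap hl
  obtain ⟨K₁, hK₁⟩ := exists_pow_lt_of_lt_one hγ hl1
  set K := K₁ + ∑ i, w i with hK
  have hwK : ∀ i, w i ≤ K := fun i =>
    (Finset.single_le_sum (fun j _ => Nat.zero_le (w j)) (Finset.mem_univ i)).trans
      (Nat.le_add_left _ _)
  refine ⟨p ^ K, pow_pos hp _, fun k => ?_⟩
  induction k using Nat.strong_induction_on with
  | _ k ih =>
    rcases lt_or_ge k K with hk | hk
    · obtain ⟨x⟩ := ‹Nonempty X›
      refine ⟨{x}, by simp, ?_⟩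
      rw [Finset.card_singleton, Nat.cast_one, one_mul]
      exact pow_le_pow_of_le_one hp.le hp1.le hk.le
    · choose S hS hcard using fun i => ih (k - w i) (by have := hw i; have := hwK i; omega)
      refine ⟨Finset.univ.biUnion fun i => (S i).image (P.map i), ?_, ?_⟩
      · intro x hx y hy hxy
        simp only [Finset.mem_biUnion, Finset.mem_univ, true_and, Finset.mem_image] at hx hy
        obtain ⟨i, x, hx, rfl⟩ := hx
        obtain ⟨j, y, hy, rfl⟩ := hy
        by_cases hij : i = j
        · subst hij
          rw [P.dist_map, show k = w i + (k - w i) by have := hwK i; omega, pow_add]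
          have := hS i x hx y hy fun h => hxy (by rw [h])
          simpa using mul_le_mul_of_nonneg_left this (pow_pos hl (w i)).le
        · refine le_trans ?_ (hgap i j hij x y)
          exact (pow_le_pow_of_le_one hl.le hl1.le (by omega)).trans hK₁.le
      · rw [Finset.card_biUnion]
        · push_cast
          rw [Finset.sum_mul, ← mul_one (p ^ K), ← hsum, Finset.mul_sum]
          refine Finset.sum_le_sum fun i _ => ?_
          rw [Finset.card_image_of_injective _ (P.map_injective hl i),
            show p ^ k = p ^ (k - w i) * p ^ w i by
              rw [← pow_add]; congr 1; have := hwK i; omega, ← mul_assoc]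
          exact mul_le_mul_of_nonneg_right (hcard i) (pow_pos hp _).le
        · intro i _ j _ hij
          rw [Function.onFun, Finset.disjoint_left]
          intro x hx hy
          obtain ⟨x, -, rfl⟩ := Finset.mem_image.mp hx
          obtain ⟨y, -, h⟩ := Finset.mem_image.mp hy
          exact hij (P.eq_of_map_eq h.symm)

/-- There are at most `C * p⁻ᵏ` points at mutual distance at least `lᵏ`, where `∑ p ^ w i = 1`. -/
theorem card_le_of_separated [CompactSpace X] [Fintype ι]
    (P : SimilarityPartition l X w) (hl : 0 < l) (hl1 : l < 1) (hw : ∀ i, 0 < w i) {p : ℝ}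
    (hp : 0 < p) (hp1 : p < 1) (hsum : ∑ i, p ^ w i = 1) :
    ∃ C : ℝ, ∀ (k : ℕ) (S : Finset X), (∀ x ∈ S, ∀ y ∈ S, x ≠ y → l ^ k ≤ dist x y) →
      S.card * p ^ k ≤ C := by
  classical
  set K := ∑ i, w i with hK
  have hwK : ∀ i, w i ≤ K := fun i =>
    Finset.single_le_sum (fun j _ => Nat.zero_le (w j)) (Finset.mem_univ i)
  have hr : 0 < l ^ K / 2 := half_pos (pow_pos hl _)
  -- For `k < K`, each ball of radius `l ^ K / 2` holds at most one point of a separated set.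
  obtain ⟨t, -, htfin, ht⟩ := (isCompact_univ (X := X)).finite_cover_balls hr
  refine ⟨htfin.toFinset.card, fun k => ?_⟩
  induction k using Nat.strong_induction_on with
  | _ k ih =>
    intro S hS
    rcases lt_or_ge k K with hk | hk
    · have hex : ∀ x : X, ∃ z ∈ t, dist x z < l ^ K / 2 := by
        intro x
        have := ht (Set.mem_univ x)
        simpa using this
      choose g hgt hg using hex
      have hle : S.card ≤ htfin.toFinset.card := by
        refine Finset.card_le_card_of_injOn g (fun x _ => by simpa using hgt x) ?_
        intro x hx y hy hxy
        by_contra hne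
        have h1 := hS x hx y hy hne
        have h2 : l ^ K ≤ l ^ k := pow_le_pow_of_le_one hl.le hl1.le hk.le
        have h3 := dist_triangle_right x y (g x)
        have h4 := hg x
        have h5 := hg y
        rw [← hxy] at h5
        linarith
      calc (S.card : ℝ) * p ^ k ≤ S.card * 1 :=
            mul_le_mul_of_nonneg_left (pow_le_one₀ hp.le hp1.le) (Nat.cast_nonneg _)
        _ ≤ _ := by rw [mul_one]; exact_mod_cast hle
    · set T : ι → Finset X := fun i => S.preimage (P.map i) (P.map_injective hl i).injOn with hT
      have hcover : S.card ≤ ∑ i, (T i).card := by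
        calc S.card ≤ (Finset.univ.biUnion fun i => (T i).image (P.map i)).card := by
              refine Finset.card_le_card fun x hx => ?_
              obtain ⟨i, y, rfl⟩ := P.exists_map_eq x
              simp only [Finset.mem_biUnion, Finset.mem_univ, true_and, Finset.mem_image]
              exact ⟨i, y, by simpa [hT] using hx, rfl⟩
          _ ≤ ∑ i, ((T i).image (P.map i)).card := Finset.card_biUnion_le
          _ ≤ ∑ i, (T i).card := Finset.sum_le_sum fun i _ => Finset.card_image_le
      calc (S.card : ℝ) * p ^ k ≤ (∑ i, ((T i).card : ℝ)) * p ^ k :=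
            mul_le_mul_of_nonneg_right (by exact_mod_cast hcover) (pow_pos hp _).le
        _ = ∑ i, ((T i).card * p ^ (k - w i)) * p ^ w i := by
            rw [Finset.sum_mul]
            refine Finset.sum_congr rfl fun i _ => ?_
            rw [mul_assoc, ← pow_add, Nat.sub_add_cancel ((hwK i).trans hk)]
        _ ≤ ∑ i, (htfin.toFinset.card : ℝ) * p ^ w i := by
            refine Finset.sum_le_sum fun i _ => ?_
            refine mul_le_mul_of_nonneg_right (ih (k - w i) ?_ (T i) ?_) (pow_pos hp _).le
            · have := hw i; have := hwK i; omega
            · intro x hx y hy hxy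
              have h1 := hS (P.map i x) (by simpa [hT] using hx) (P.map i y)
                (by simpa [hT] using hy) ((P.map_injective hl i).ne hxy)
              rw [P.dist_map, ← Nat.add_sub_cancel' ((hwK i).trans hk), pow_add] at h1
              exact le_of_mul_le_mul_left h1 (pow_pos hl _)
        _ = htfin.toFinset.card := by rw [← Finset.mul_sum, hsum, mul_one]

/-- Such a `φ` sends `lᵏ`-separated sets to `lᵏ⁺ᴸ`-separated ones with `L` fixed, so the two counts
bound `(q / p) ^ k` uniformly in `k`. -/
theorem le_of_dist_le_mul [CompactSpace X] [CompactSpace Y] [Nonempty X] [Fintype ι] [Fintype κ]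
    (P : SimilarityPartition l X w) (Q : SimilarityPartition l Y v) (hl : 0 < l) (hl1 : l < 1)
    (hw : ∀ i, 0 < w i) (hv : ∀ i, 0 < v i) {p q : ℝ} (hp : 0 < p) (hp1 : p < 1)
    (hpsum : ∑ i, p ^ w i = 1) (hq : 0 < q) (hq1 : q < 1) (hqsum : ∑ i, q ^ v i = 1)
    {φ : X → Y} {C : ℝ} (hC : 0 < C) (hφ : ∀ x y, dist x y ≤ C * dist (φ x) (φ y)) : q ≤ p := by
  classical
  obtain ⟨c, hc, hlow⟩ := P.exists_separated_finset hl hl1 hw hp hp1 hpsum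
  obtain ⟨D, hup⟩ := Q.card_le_of_separated hl hl1 hv hq hq1 hqsum
  obtain ⟨L, hL⟩ := exists_pow_lt_of_lt_one (inv_pos.mpr hC) hl1
  have hinj : Function.Injective φ := by
    intro x y h
    have := hφ x y
    rw [h, dist_self, mul_zero] at this
    exact dist_le_zero.mp this
  have key : ∀ k : ℕ, (q / p) ^ k ≤ D / (c * q ^ L) := by
    intro k
    obtain ⟨S, hS, hcard⟩ := hlow k
    have h1 := hup (k + L) (S.image φ) (by
      intro x hx y hy hxy
      obtain ⟨x, hxS, rfl⟩ := Finset.mem_image.mp hx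
      obtain ⟨y, hyS, rfl⟩ := Finset.mem_image.mp hy
      have h2 := hS x hxS y hyS fun h => hxy (by rw [h])
      calc l ^ (k + L) = l ^ k * l ^ L := pow_add _ _ _
        _ ≤ dist x y * C⁻¹ := mul_le_mul h2 hL.le (pow_pos hl _).le dist_nonneg
        _ ≤ (C * dist (φ x) (φ y)) * C⁻¹ :=
          mul_le_mul_of_nonneg_right (hφ x y) (inv_pos.mpr hC).le
        _ = dist (φ x) (φ y) := by field_simp)
    rw [Finset.card_image_of_injective _ hinj, pow_add] at h1
    rw [le_div_iff₀ (by positivity), div_pow, div_mul_eq_mul_div, div_le_iff₀ (by positivity)]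
    calc q ^ k * (c * q ^ L) ≤ q ^ k * ((S.card * p ^ k) * q ^ L) := by gcongr
      _ = (S.card * (q ^ k * q ^ L)) * p ^ k := by ring
      _ ≤ D * p ^ k := by gcongr
  by_contra! hlt
  obtain ⟨k, hk⟩ := pow_unbounded_of_one_lt (D / (c * q ^ L)) ((one_lt_div hp).mpr hlt)
  exact absurd (key k) (not_le.mpr hk)

end SimilarityPartition
end SimilarityPartitions

/-! ### Addresses, and the bi-Lipschitz map that preserves them. -/

noncomputable section SimilarityPartitions

open Filter Topology

namespace SimilarityPartition

variable {l : ℝ} {X Y : Type*} [MetricSpace X] [MetricSpace Y] {ι κ : Type*} {w : ι → ℕ}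
  {v : κ → ℕ}

/-- The index of the piece that contains a point. -/
def index (P : SimilarityPartition l X w) (x : X) : ι := (P.exists_map_eq x).choose

/-- The point whose image is the given point. -/
def shift (P : SimilarityPartition l X w) (x : X) : X := (P.exists_map_eq x).choose_spec.choose

theorem map_index_shift (P : SimilarityPartition l X w) (x : X) :
    P.map (P.index x) (P.shift x) = x := (P.exists_map_eq x).choose_spec.choose_spec

theorem index_map (P : SimilarityPartition l X w) (i : ι) (x : X) : P.index (P.map i x) = i :=
  P.eq_of_map_eq (P.map_index_shift (P.map i x))

theorem shift_map (P : SimilarityPartition l X w) (hl : 0 < l) (i : ι) (x : X) :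
    P.shift (P.map i x) = x := by
  refine P.map_injective hl i ?_
  conv_rhs => rw [← P.map_index_shift (P.map i x), P.index_map]

/-- The address of a point. -/
def address (P : SimilarityPartition l X w) (x : X) (n : ℕ) : ι := P.index (P.shift^[n] x)

theorem address_map_succ (P : SimilarityPartition l X w) (hl : 0 < l) (i : ι) (x : X) (n : ℕ) :
    P.address (P.map i x) (n + 1) = P.address x n := by
  rw [address, address, Function.iterate_succ_apply, P.shift_map hl]

theorem dist_eq_of_address_eq (P : SimilarityPartition l X w) {x y : X} {n : ℕ}
    (h : ∀ k < n, P.address x k = P.address y k) :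
    dist x y = l ^ (∑ k ∈ Finset.range n, w (P.address x k)) *
      dist (P.shift^[n] x) (P.shift^[n] y) := by
  induction n with
  | zero => simp
  | succ n ih =>
    rw [ih fun k hk => h k (by omega), Finset.sum_range_succ, pow_add, mul_assoc,
      Function.iterate_succ_apply', Function.iterate_succ_apply']
    congr 1
    have h1 := P.map_index_shift (P.shift^[n] x)
    have h2 := P.map_index_shift (P.shift^[n] y)
    have h3 : P.index (P.shift^[n] y) = P.index (P.shift^[n] x) := (h n (by omega)).symm
    rw [h3] at h2
    conv_lhs => rw [← h1, ← h2]
    rw [P.dist_map]; rfl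

theorem address_injective [CompactSpace X] (P : SimilarityPartition l X w) (hl : 0 < l)
    (hl1 : l < 1) (hw : ∀ i, 0 < w i) : Function.Injective P.address := by
  intro x y h
  have hD : ∀ a b : X, dist a b ≤ Metric.diam (Set.univ : Set X) := fun a b =>
    Metric.dist_le_diam_of_mem isCompact_univ.isBounded (Set.mem_univ _) (Set.mem_univ _)
  have key : ∀ n : ℕ, dist x y ≤ l ^ n * Metric.diam (Set.univ : Set X) := by
    intro n
    rw [P.dist_eq_of_address_eq (n := n) fun k _ => congrFun h k]
    refine mul_le_mul ?_ (hD _ _) dist_nonneg (pow_pos hl _).le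
    refine pow_le_pow_of_le_one hl.le hl1.le ?_
    calc n = ∑ k ∈ Finset.range n, 1 := by simp
      _ ≤ _ := Finset.sum_le_sum fun k _ => hw _
  have hlim : Tendsto (fun n : ℕ => l ^ n * Metric.diam (Set.univ : Set X)) atTop (𝓝 0) := by
    simpa using (tendsto_pow_atTop_nhds_zero_of_lt_one hl.le hl1).mul_const
      (Metric.diam (Set.univ : Set X))
  exact dist_le_zero.mp (ge_of_tendsto' hlim key)

/-- The composition of the similarities along the first letters of a sequence. -/
def wordMap (P : SimilarityPartition l X w) : (ℕ → ι) → ℕ → X → X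
  | _, 0 => id
  | σ, n + 1 => P.map (σ 0) ∘ wordMap P (fun k => σ (k + 1)) n

theorem continuous_wordMap (P : SimilarityPartition l X w) (hl : 0 < l) (σ : ℕ → ι) (n : ℕ) :
    Continuous (P.wordMap σ n) := by
  induction n generalizing σ with
  | zero => exact continuous_id
  | succ n ih => exact (P.continuous_map hl _).comp (ih _)

theorem range_wordMap_succ_subset (P : SimilarityPartition l X w) (σ : ℕ → ι) (n : ℕ) :
    Set.range (P.wordMap σ (n + 1)) ⊆ Set.range (P.wordMap σ n) := by
  induction n generalizing σ with
  | zero => simp [wordMap]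
  | succ n ih =>
    rintro _ ⟨y, rfl⟩
    obtain ⟨z, hz⟩ := ih (fun k => σ (k + 1)) ⟨y, rfl⟩
    exact ⟨z, congrArg (P.map (σ 0)) hz⟩

theorem address_wordMap (P : SimilarityPartition l X w) (hl : 0 < l) (σ : ℕ → ι) {n k : ℕ}
    (hk : k < n) (x : X) : P.address (P.wordMap σ n x) k = σ k := by
  induction n generalizing σ k with
  | zero => omega
  | succ n ih =>
    rw [wordMap, Function.comp_apply]
    cases k with
    | zero => exact P.index_map _ _
    | succ k => rw [P.address_map_succ hl, ih _ (by omega)]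

/-- The nested compact images along the prefixes of a sequence have a common point. -/
theorem address_surjective [CompactSpace X] [Nonempty X] (P : SimilarityPartition l X w)
    (hl : 0 < l) : Function.Surjective P.address := by
  intro σ
  have hcpt : ∀ n, IsCompact (Set.range (P.wordMap σ n)) := fun n =>
    isCompact_range (P.continuous_wordMap hl σ n)
  obtain ⟨x, hx⟩ := IsCompact.nonempty_iInter_of_sequence_nonempty_isCompact_isClosed
    (fun n => Set.range (P.wordMap σ n)) (P.range_wordMap_succ_subset σ)
    (fun n => Set.range_nonempty _) (hcpt 0) (fun n => (hcpt n).isClosed)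
  refine ⟨x, funext fun k => ?_⟩
  obtain ⟨y, rfl⟩ := Set.mem_iInter.mp hx (k + 1)
  exact P.address_wordMap hl σ (Nat.lt_succ_self k) y

/-- Compact spaces with similarity partitions of the same ratios are bi-Lipschitz equivalent. -/
theorem exists_biLipschitz_equiv [CompactSpace X] [CompactSpace Y] [Nonempty X] [Nonempty Y]
    [Finite ι] (P : SimilarityPartition l X w) (Q : SimilarityPartition l Y w) (hl : 0 < l)
    (hl1 : l < 1) (hw : ∀ i, 0 < w i) :
    ∃ (φ : X ≃ Y) (C : ℝ), 0 < C ∧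
      ∀ x y, C⁻¹ * dist x y ≤ dist (φ x) (φ y) ∧ dist (φ x) (φ y) ≤ C * dist x y := by
  classical
  obtain ⟨γ, hγ, hgapX⟩ := P.exists_gap hl
  obtain ⟨δ, hδ, hgapY⟩ := Q.exists_gap hl
  obtain ⟨D, hD⟩ : ∃ D : ℝ, ∀ a b : X, dist a b ≤ D := ⟨_, fun a b =>
    Metric.dist_le_diam_of_mem isCompact_univ.isBounded (Set.mem_univ a) (Set.mem_univ b)⟩
  obtain ⟨D', hD'⟩ : ∃ D : ℝ, ∀ a b : Y, dist a b ≤ D := ⟨_, fun a b =>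
    Metric.dist_le_diam_of_mem isCompact_univ.isBounded (Set.mem_univ a) (Set.mem_univ b)⟩
  have hD0 : 0 ≤ D := by
    obtain ⟨a⟩ := ‹Nonempty X›; simpa using hD a a
  have hD0' : 0 ≤ D' := by
    obtain ⟨a⟩ := ‹Nonempty Y›; simpa using hD' a a
  let eX : X ≃ (ℕ → ι) := Equiv.ofBijective P.address
    ⟨P.address_injective hl hl1 hw, P.address_surjective hl⟩
  let eY : Y ≃ (ℕ → ι) := Equiv.ofBijective Q.address
    ⟨Q.address_injective hl hl1 hw, Q.address_surjective hl⟩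
  let φ : X ≃ Y := eX.trans eY.symm
  have hφ : ∀ x, Q.address (φ x) = P.address x := fun x => eY.apply_symm_apply (eX x)
  have hpos : 0 < D' / γ + D / δ + 1 := by positivity
  refine ⟨φ, D' / γ + D / δ + 1, hpos, fun x y => ?_⟩
  by_cases hxy : x = y
  · subst hxy; simp
  have hex : ∃ n, P.address x n ≠ P.address y n := by
    by_contra! h
    exact hxy (P.address_injective hl hl1 hw (funext h))
  have hmin : ∀ k < Nat.find hex, P.address x k = P.address y k := fun k hk =>
    not_not.mp (Nat.find_min hex hk)
  have hne := Nat.find_spec hex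
  set n := Nat.find hex
  have dX := P.dist_eq_of_address_eq hmin
  have dY := Q.dist_eq_of_address_eq (x := φ x) (y := φ y) (n := n) fun k hk => by
    rw [hφ, hφ]; exact hmin k hk
  rw [hφ] at dY
  -- The common prefix contributes the same factor `r` to both distances; the remaining factors lie
  -- between the gap and a diameter bound.
  set r := l ^ (∑ k ∈ Finset.range n, w (P.address x k)) with hr
  have hr0 : 0 < r := pow_pos hl _
  have gX : γ ≤ dist (P.shift^[n] x) (P.shift^[n] y) := by
    have := hgapX _ _ hne (P.shift (P.shift^[n] x)) (P.shift (P.shift^[n] y))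
    rwa [address, address, P.map_index_shift, P.map_index_shift] at this
  have gY : δ ≤ dist (Q.shift^[n] (φ x)) (Q.shift^[n] (φ y)) := by
    rw [← hφ x, ← hφ y] at hne
    have := hgapY _ _ hne (Q.shift (Q.shift^[n] (φ x))) (Q.shift (Q.shift^[n] (φ y)))
    rwa [address, address, Q.map_index_shift, Q.map_index_shift] at this
  have uX := hD (P.shift^[n] x) (P.shift^[n] y)
  have uY := hD' (Q.shift^[n] (φ x)) (Q.shift^[n] (φ y))
  constructor
  · rw [inv_mul_le_iff₀ hpos, dX, dY]
    calc r * dist (P.shift^[n] x) (P.shift^[n] y) ≤ r * D := by gcongr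
      _ = D / δ * (r * δ) := by field_simp
      _ ≤ (D' / γ + D / δ + 1) * (r * dist (Q.shift^[n] (φ x)) (Q.shift^[n] (φ y))) := by
        gcongr
        have : 0 ≤ D' / γ := by positivity
        linarith
  · rw [dX, dY]
    calc r * dist (Q.shift^[n] (φ x)) (Q.shift^[n] (φ y)) ≤ r * D' := by gcongr
      _ = D' / γ * (r * γ) := by field_simp
      _ ≤ (D' / γ + D / δ + 1) * (r * dist (P.shift^[n] x) (P.shift^[n] y)) := by
        gcongr
        have : 0 ≤ D / δ := by positivity
        linarith

/-- Reindexing of a similarity partition. -/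
def reindex (P : SimilarityPartition l X w) (σ : κ ≃ ι) (h : ∀ j, w (σ j) = v j) :
    SimilarityPartition l X v where
  map j := P.map (σ j)
  dist_map j x y := by rw [P.dist_map, h]
  exists_map_eq x := by
    obtain ⟨i, y, h⟩ := P.exists_map_eq x
    exact ⟨σ.symm i, y, by rw [σ.apply_symm_apply, h]⟩
  eq_of_map_eq h := σ.injective (P.eq_of_map_eq h)

/-- Replacing the piece of index `i₀` by the pieces of another partition inside it. -/
def refine (P : SimilarityPartition l X w) (Q : SimilarityPartition l X v) (hl : 0 < l) (i₀ : ι) :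
    SimilarityPartition l X
      (Sum.elim (fun i : {i // i ≠ i₀} => w i) (fun j => w i₀ + v j)) where
  map := Sum.elim (fun i => P.map i) (fun j => P.map i₀ ∘ Q.map j)
  dist_map := by
    rintro (i | j) x y
    · exact P.dist_map _ _ _
    · simp only [Sum.elim_inr, Function.comp_apply, P.dist_map, Q.dist_map, pow_add, mul_assoc]
  exists_map_eq x := by
    obtain ⟨i, y, rfl⟩ := P.exists_map_eq x
    by_cases hi : i = i₀
    · obtain ⟨j, z, rfl⟩ := Q.exists_map_eq y
      exact ⟨Sum.inr j, z, by rw [hi]; rfl⟩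
    · exact ⟨Sum.inl ⟨i, hi⟩, y, rfl⟩
  eq_of_map_eq := by
    rintro (i | j) (i' | j') x y h
    · exact congrArg Sum.inl (Subtype.ext (P.eq_of_map_eq h))
    · exact absurd (P.eq_of_map_eq h) i.2
    · exact absurd (P.eq_of_map_eq h).symm i'.2
    · exact congrArg Sum.inr (Q.eq_of_map_eq (P.map_injective hl i₀ h))

end SimilarityPartition

/-! ### Multisets of exponents and their subdivision. -/

/-- `X` is partitioned into images of itself under similarities of ratios `l ^ k`, `k ∈ s`. -/
def HasSimilarityPartition (l : ℝ) (X : Type*) [MetricSpace X] (s : Multiset ℕ) : Prop :=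
  ∃ (ι : Type) (_ : Fintype ι) (w : ι → ℕ), Nonempty (SimilarityPartition l X w) ∧
    ∑ i, ({w i} : Multiset ℕ) = s

/-- Replace one occurrence of `k` in `s` by `k + t`. -/
def Multiset.splitAt (t s : Multiset ℕ) (k : ℕ) : Multiset ℕ :=
  if k ∈ s then s.erase k + t.map (k + ·) else s

namespace HasSimilarityPartition

variable {l : ℝ} {X Y : Type*} [MetricSpace X] [MetricSpace Y] {s t : Multiset ℕ}

theorem splitAt (hl : 0 < l) (ht : HasSimilarityPartition l X t)
    (hs : HasSimilarityPartition l X s) (k : ℕ) : HasSimilarityPartition l X (t.splitAt s k) := by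
  classical
  rw [Multiset.splitAt]
  split_ifs with hk
  · obtain ⟨ι, _, w, ⟨P⟩, rfl⟩ := hs
    obtain ⟨κ, _, v, ⟨Q⟩, rfl⟩ := ht
    obtain ⟨i₀, -, hi₀⟩ := Multiset.mem_sum.mp hk
    rw [Multiset.mem_singleton] at hi₀
    subst hi₀
    refine ⟨_, inferInstance, _, ⟨P.refine Q hl i₀⟩, ?_⟩
    rw [Fintype.sum_sum_type, Fintype.sum_eq_add_sum_subtype_ne _ i₀, Multiset.singleton_add,
      Multiset.erase_cons_head, ← Multiset.coe_mapAddMonoidHom, map_sum]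
    simp
  · exact hs

theorem foldl_splitAt (hl : 0 < l) (ht : HasSimilarityPartition l X t) (L : List ℕ)
    (hs : HasSimilarityPartition l X s) : HasSimilarityPartition l X (L.foldl t.splitAt s) := by
  induction L generalizing s with
  | nil => exact hs
  | cons k L ih => exact ih (ht.splitAt hl hs k)

theorem exists_biLipschitz_equiv [CompactSpace X] [CompactSpace Y] [Nonempty X] [Nonempty Y]
    (hX : HasSimilarityPartition l X s) (hY : HasSimilarityPartition l Y s) (hl : 0 < l)
    (hl1 : l < 1) (hs : ∀ k ∈ s, 0 < k) :
    ∃ (φ : X ≃ Y) (C : ℝ), 0 < C ∧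
      ∀ x y, C⁻¹ * dist x y ≤ dist (φ x) (φ y) ∧ dist (φ x) (φ y) ≤ C * dist x y := by
  classical
  obtain ⟨ι, _, w, ⟨P⟩, rfl⟩ := hX
  obtain ⟨κ, _, v, ⟨Q⟩, hv⟩ := hY
  -- Equal multiplicities of every exponent yield a bijection of the index types that preserves
  -- exponents.
  have hcard : ∀ n, Nonempty ({i // w i = n} ≃ {j // v j = n}) := by
    intro n
    refine ⟨Fintype.equivOfCardEq ?_⟩
    have := congrArg (Multiset.count n) hv
    rw [Multiset.count_sum', Multiset.count_sum'] at this
    simp only [Multiset.count_singleton, Finset.sum_boole, Nat.cast_id] at this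
    rw [Fintype.card_subtype, Fintype.card_subtype]
    simp only [eq_comm (b := n)]
    exact this.symm
  let σ : ι ≃ κ := Equiv.ofFiberEquiv fun n => (hcard n).some
  exact P.exists_biLipschitz_equiv
    (Q.reindex σ fun i => Equiv.ofFiberEquiv_map (fun n => (hcard n).some) i) hl hl1
    fun i => hs _ (Multiset.mem_sum.mpr ⟨i, Finset.mem_univ i, Multiset.mem_singleton_self _⟩)

end HasSimilarityPartition
end SimilarityPartitions

/-! ### Application to dust-like sets. -/

section DustLikeSets

theorem DustLike.nonempty_similarityPartition {N m : ℕ} {l : ℝ} (hl : 0 < l) {w : Fin m → ℕ}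
    {E : Set (EuclideanSpace ℝ (Fin N))} (hE : E ∈ DustLike N fun i => l ^ w i) :
    Nonempty E ∧ CompactSpace E ∧ Nonempty (SimilarityPartition l E w) := by
  obtain ⟨hne, hc, R, d, hcov, hdisj⟩ := hE
  have hmem : ∀ i, ∀ x ∈ E, l ^ w i • R i (x + d i) ∈ E := by
    intro i x hx
    rw [hcov]
    exact Set.mem_iUnion.mpr ⟨i, x, hx, rfl⟩
  refine ⟨hne.to_subtype, isCompact_iff_compactSpace.mp hc,
    ⟨⟨fun i x => ⟨l ^ w i • R i (x + d i), hmem i x x.2⟩, ?_, ?_, ?_⟩⟩⟩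
  · intro i x y
    rw [Subtype.dist_eq, Subtype.dist_eq, dist_smul₀, LinearIsometryEquiv.dist_map,
      dist_add_right, Real.norm_of_nonneg (pow_pos hl _).le]
  · rintro ⟨x, hx⟩
    have hx' := hx
    rw [hcov] at hx'
    obtain ⟨i, y, hy, h⟩ := Set.mem_iUnion.mp hx'
    exact ⟨i, ⟨y, hy⟩, Subtype.ext h⟩
  · intro i j x y h
    by_contra hij
    exact Set.disjoint_left.mp (hdisj i j hij) ⟨x, x.2, rfl⟩
      ⟨y, y.2, (congrArg Subtype.val h).symm⟩

theorem DustLike.similarityPartition_three {N : ℕ} {l : ℝ} (hl : 0 < l) {a b c : ℕ}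
    {E : Set (EuclideanSpace ℝ (Fin N))} (hE : E ∈ DustLike N ![l ^ a, l ^ b, l ^ c]) :
    Nonempty E ∧ CompactSpace E ∧ Nonempty (SimilarityPartition l E ![a, b, c]) := by
  refine DustLike.nonempty_similarityPartition hl (?_ : E ∈ DustLike N _)
  convert hE using 2
  ext i; fin_cases i <;> rfl

theorem DustLike.similarityPartition_two {N : ℕ} {l : ℝ} (hl : 0 < l) {d e : ℕ}
    {E : Set (EuclideanSpace ℝ (Fin N))} (hE : E ∈ DustLike N ![l ^ d, l ^ e]) :
    Nonempty E ∧ CompactSpace E ∧ Nonempty (SimilarityPartition l E ![d, e]) := by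
  refine DustLike.nonempty_similarityPartition hl (?_ : E ∈ DustLike N _)
  convert hE using 2
  ext i; fin_cases i <;> rfl

/-- Every equation `∑ p ^ w i = 1` with at least two positive exponents has a root in `(0, 1)`. -/
theorem exists_root_sum_pow_eq_one {m : ℕ} (w : Fin (m + 2) → ℕ) (hw : ∀ i, 0 < w i) :
    ∃ p : ℝ, 0 < p ∧ p < 1 ∧ ∑ i, p ^ w i = 1 := by
  have hcont : Continuous fun p : ℝ => ∑ i, p ^ w i := by fun_prop
  have h0 : ∑ i, (0 : ℝ) ^ w i = 0 := Finset.sum_eq_zero fun i _ => zero_pow (hw i).ne'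
  have h1 : ∑ i, (1 : ℝ) ^ w i = m + 2 := by simp
  obtain ⟨p, ⟨hp0, hp1⟩, hp⟩ := intermediate_value_Ioo (zero_le_one (α := ℝ)) hcont.continuousOn
    (show (1 : ℝ) ∈ Set.Ioo (∑ i, (0 : ℝ) ^ w i) (∑ i, (1 : ℝ) ^ w i) by
      rw [h0, h1]; constructor <;> [norm_num; linarith [(Nat.cast_nonneg m : (0 : ℝ) ≤ m)]])
  exact ⟨p, hp0, hp1, hp⟩

/-- Each set has its own root in `(0, 1)`; the two Lipschitz bounds give the two inequalities
between them. -/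
theorem exists_common_root_of_dustLikeEquivalent {N : ℕ} {l : ℝ} (hl : 0 < l) (hl1 : l < 1)
    {a b c d e : ℕ} (ha : 0 < a) (hb : 0 < b) (hc : 0 < c) (hd : 0 < d) (he : 0 < e)
    (h : DustLikeEquivalent N ![l ^ a, l ^ b, l ^ c] ![l ^ d, l ^ e]) :
    ∃ p : ℝ, 0 < p ∧ p < 1 ∧ p ^ a + p ^ b + p ^ c = 1 ∧ p ^ d + p ^ e = 1 := by
  obtain ⟨E, hE, F, hF, φ, C, hC, hφ⟩ := h
  obtain ⟨_, _, ⟨P⟩⟩ := DustLike.similarityPartition_three hl hE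
  obtain ⟨_, _, ⟨Q⟩⟩ := DustLike.similarityPartition_two hl hF
  have hw : ∀ i, 0 < ![a, b, c] i := by intro i; fin_cases i <;> assumption
  have hv : ∀ i, 0 < ![d, e] i := by intro i; fin_cases i <;> assumption
  obtain ⟨p, hp0, hp1, hp⟩ := exists_root_sum_pow_eq_one _ hw
  obtain ⟨q, hq0, hq1, hq⟩ := exists_root_sum_pow_eq_one _ hv
  have hqp : q ≤ p := P.le_of_dist_le_mul Q hl hl1 hw hv hp0 hp1 hp hq0 hq1 hq hC fun x y =>
    (inv_mul_le_iff₀ hC).mp (hφ x y).1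
  have hpq : p ≤ q := Q.le_of_dist_le_mul P hl hl1 hv hw hq0 hq1 hq hp0 hp1 hp (φ := φ.symm) hC
    fun x y => by simpa using (hφ (φ.symm x) (φ.symm y)).2
  obtain rfl := le_antisymm hpq hqp
  refine ⟨p, hp0, hp1, ?_, ?_⟩
  · simpa [Fin.sum_univ_three] using hp
  · simpa [Fin.sum_univ_two] using hq

/-- Two families of dust-like sets are equivalent if refining their ratios leads to the same
ratios. -/
theorem dustLikeEquivalent_of_foldl_splitAt {N : ℕ} {l : ℝ} (hl : 0 < l) (hl1 : l < 1)
    {a b c d e : ℕ} (hα : (DustLike N ![l ^ a, l ^ b, l ^ c]).Nonempty)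
    (hβ : (DustLike N ![l ^ d, l ^ e]).Nonempty) (L L' : List ℕ)
    (hLL' : L.foldl (Multiset.splitAt {a, b, c}) {a, b, c} =
      L'.foldl (Multiset.splitAt {d, e}) {d, e})
    (hpos : ∀ k ∈ L.foldl (Multiset.splitAt {a, b, c}) {a, b, c}, 0 < k) :
    DustLikeEquivalent N ![l ^ a, l ^ b, l ^ c] ![l ^ d, l ^ e] := by
  obtain ⟨E, hE⟩ := hα
  obtain ⟨F, hF⟩ := hβ
  obtain ⟨_, _, hP⟩ := DustLike.similarityPartition_three hl hE
  obtain ⟨_, _, hQ⟩ := DustLike.similarityPartition_two hl hF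
  have hX : HasSimilarityPartition l E {a, b, c} :=
    ⟨_, inferInstance, _, hP, by simp [Fin.sum_univ_three]⟩
  have hY : HasSimilarityPartition l F {d, e} :=
    ⟨_, inferInstance, _, hQ, by simp [Fin.sum_univ_two]⟩
  refine ⟨E, hE, F, hF, ?_⟩
  exact (hX.foldl_splitAt hl L hX).exists_biLipschitz_equiv
    (hLL' ▸ hY.foldl_splitAt hl L' hY) hl hl1 hpos

end DustLikeSets

/-! ### The classification. -/

theorem mainTheorem2 (N : ℕ) (l : ℝ) (hl0 : 0 < l) (hl1 : l < 1)
    (a b c d e : ℕ) (ha : 0 < a) (hb : 0 < b) (hc : 0 < c) (hd : 0 < d) (he : 0 < e)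
    (hα : IsContractionVector N ![l ^ a, l ^ b, l ^ c])
    (hβ : IsContractionVector N ![l ^ d, l ^ e])
    (hαne : (DustLike N ![l ^ a, l ^ b, l ^ c]).Nonempty)
    (hβne : (DustLike N ![l ^ d, l ^ e]).Nonempty)
    (habc : a = b + c) (hgcd : Nat.gcd a (Nat.gcd b c) = 1) :
    DustLikeEquivalent N ![l ^ a, l ^ b, l ^ c] ![l ^ d, l ^ e] ↔
      (a = 4 ∧ ({b, c} : Set ℕ) = {1, 3} ∧ ({d, e} : Set ℕ) = {1, 2}) ∨
      (a = 8 ∧ ({b, c} : Set ℕ) = {1, 7} ∧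
        (({d, e} : Set ℕ) = {1, 5} ∨ ({d, e} : Set ℕ) = {2, 3})) := by
  simp only [Set.pair_eq_pair_iff]
  constructor
  · intro h
    have hcop : b.Coprime c := by
      rw [Nat.Coprime, ← hgcd, eq_comm]
      refine Nat.gcd_eq_right ?_
      rw [habc]
      exact dvd_add (Nat.gcd_dvd_left b c) (Nat.gcd_dvd_right b c)
    obtain ⟨p, hp0, hp1, hA, hB⟩ :=
      exists_common_root_of_dustLikeEquivalent hl0 hl1 ha hb hc hd he h
    rw [habc] at hA
    have hA' : p ^ (c + b) + p ^ c + p ^ b = 1 := by rw [add_comm c b, ← hA]; ring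
    have hB' : p ^ e + p ^ d = 1 := by rw [← hB]; ring
    rcases le_total b c with hbc | hbc <;> rcases le_total e d with hed | hed
    · have := exponents_of_common_root hp0 hp1 hb hbc hcop he hed hA hB
      omega
    · have := exponents_of_common_root hp0 hp1 hb hbc hcop hd hed hA hB'
      omega
    · have := exponents_of_common_root hp0 hp1 hc hbc hcop.symm he hed hA' hB
      omega
    · have := exponents_of_common_root hp0 hp1 hc hbc hcop.symm hd hed hA' hB'
      omega
  · rintro (⟨rfl, ⟨rfl, rfl⟩ | ⟨rfl, rfl⟩, ⟨rfl, rfl⟩ | ⟨rfl, rfl⟩⟩ |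
      ⟨rfl, ⟨rfl, rfl⟩ | ⟨rfl, rfl⟩, (⟨rfl, rfl⟩ | ⟨rfl, rfl⟩) | (⟨rfl, rfl⟩ | ⟨rfl, rfl⟩)⟩)
    -- Splitting at `k` adds `x ^ k * (∑ x ^ w i - 1)` to the generating polynomial minus `1`, so
    -- the lists encode multipliers equalizing both sides. Here `x^4 + x^3 + x - 1 = (1 + x^2) *
    -- (x^2 + x - 1)`.
    iterate 4
      exact dustLikeEquivalent_of_foldl_splitAt hl0 hl1 hαne hβne [] [2] (by decide) (by decide)
    iterate 2
      iterate 2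
        -- The multiplier `1 + x + ⋯ + x^5` contains the factor `x^2 - x + 1` of `x^5 + x - 1` and
        -- makes the cofactor's coefficients nonnegative.
        exact dustLikeEquivalent_of_foldl_splitAt hl0 hl1 hαne hβne [1, 2, 3, 4, 5]
          [1, 2, 3, 4, 5, 5, 6, 6, 7, 7, 8] (by decide) (by decide)
      iterate 2
        -- The multiplier `1 + x + x^2` removes the negative term of the cofactor `(x^2 + 1) * (x^3
        -- - x + 1)`.
        exact dustLikeEquivalent_of_foldl_splitAt hl0 hl1 hαne hβne [1, 2]
          [2, 4, 5, 6, 7] (by decide) (by decide)
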